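/- Let $n\ge 4$ be an integer. Let $\mathbb{H}^n=\mathbb{R}^{2n}\times\mathbb{R}$ be the Heisenberg group with the group law $$(x',x_{2n+1})\cdot(y',y_{2n+1})=\Big(x'+y',\;x_{2n+1}+y_{2n+1}-2\sum_{j=1}^n(x_jy_{j+n}-x_{j+n}y_j)\Big)$$ and the Korányi metric $d_H(x,y)=\|x^{-1}\cdot y\|$, where $\|x\|=(\|x'\|_{\mathbb{R}^{2n}}^4+x_{2n+1}^2)^{1/4}$. Let $B(x,r)$ denote the closed $d_H$-ball. For $s>0$, a Radon measure $\mu$ on $(\mathbb{H}^n,d_H)$ is called $s$-uniform if there is a constant $c>0$ such that $\mu(B(x,r))=c\,r^s$ for all $x\in\operatorname{supp}(\mu)$ and all $r>0$. A set $S\subset\mathbb{H}^n$ supports an $s$-uniform measure if $S=\operatorname{supp}(\mu)$ for some $s$-uniform measure $\mu$. Let $$C=\{x\in\mathbb{R}^4 : x_4^2=x_1^2+x_2^2+x_3^2\}$$ be the light cone, and let $k$ be an integer with $4\le k\le n$. (i) The set $$C_H=\{(x_1,\ldots,x_k,0,\ldots,0,0)\in\mathbb{H}^n : (x_1,x_2,x_3,x_4)\in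 C\},$$ and also the image of $C_H$ under any isometry of $(\mathbb{H}^n,d_H)$, supports a $(k-1)$-uniform measure. (ii) The set $$\tilde C_H=\{(x_1,\ldots,x_k,0,\ldots,0,x_{2n+1})\in\mathbb{H}^n : (x_1,x_2,x_3,x_4)\in C,\ x_{2n+1}\in\mathbb{R}\},$$ and also the image of $\tilde C_H$ under any isometry of $(\mathbb{H}^n,d_H)$, supports a $(k+1)$-uniform measure. -/

import Mathlib

open MeasureTheory

noncomputable section

/-- The symplectic form `A(z, w) = -2 ∑ⱼ (zⱼ wⱼ₊ₙ - zⱼ₊ₙ wⱼ)` on `ℝ²ⁿ`. The coordinates of `ℝ²ⁿ`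
are indexed by `Fin n ⊕ Fin n`: `Sum.inl j` is the `j`-th and `Sum.inr j` the `(j+n)`-th. -/
def symplecticForm {n : ℕ} (z w : EuclideanSpace ℝ (Fin n ⊕ Fin n)) : ℝ :=
  -2 * ∑ j : Fin n, (z (Sum.inl j) * w (Sum.inr j) - z (Sum.inr j) * w (Sum.inl j))

/-- The underlying set `ℝ²ⁿ × ℝ` of the `n`-th Heisenberg group: a point has a horizontal part
`z ∈ ℝ²ⁿ` and a vertical coordinate `t`. -/
@[ext]
structure Heisenberg (n : ℕ) where
  /-- the first `2n` coordinates -/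
  z : EuclideanSpace ℝ (Fin n ⊕ Fin n)
  /-- the last coordinate -/
  t : ℝ

namespace Heisenberg

variable {n : ℕ}

/-- The group law `(z, t) · (w, s) = (z + w, t + s + A(z, w))`. -/
instance : Mul (Heisenberg n) :=
  ⟨fun p q => ⟨p.z + q.z, p.t + q.t + symplecticForm p.z q.z⟩⟩

instance : One (Heisenberg n) := ⟨⟨0, 0⟩⟩

instance : Inv (Heisenberg n) := ⟨fun p => ⟨-p.z, -p.t⟩⟩

theorem mul_z (p q : Heisenberg n) : (p * q).z = p.z + q.z := rfl

theorem mul_t (p q : Heisenberg n) :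
    (p * q).t = p.t + q.t + symplecticForm p.z q.z := rfl

theorem one_z : (1 : Heisenberg n).z = 0 := rfl

theorem one_t : (1 : Heisenberg n).t = 0 := rfl

theorem inv_z (p : Heisenberg n) : (p⁻¹).z = -p.z := rfl

theorem inv_t (p : Heisenberg n) : (p⁻¹).t = -p.t := rfl

theorem symplecticForm_add_left (u v w : EuclideanSpace ℝ (Fin n ⊕ Fin n)) :
    symplecticForm (u + v) w = symplecticForm u w + symplecticForm v w := by
  simp only [symplecticForm, PiLp.add_apply, ← mul_add, ← Finset.sum_add_distrib]
  congr 1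
  exact Finset.sum_congr rfl fun j _ => by ring

theorem symplecticForm_add_right (u v w : EuclideanSpace ℝ (Fin n ⊕ Fin n)) :
    symplecticForm u (v + w) = symplecticForm u v + symplecticForm u w := by
  simp only [symplecticForm, PiLp.add_apply, ← mul_add, ← Finset.sum_add_distrib]
  congr 1
  exact Finset.sum_congr rfl fun j _ => by ring

instance : Group (Heisenberg n) :=
  Group.ofLeftAxioms
    (fun a b c => by
      ext1
      · simp only [mul_z, add_assoc]
      · simp only [mul_t, mul_z, symplecticForm_add_left, symplecticForm_add_right]
        ring)
    (fun a => by
      ext1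
      · simp [mul_z, one_z]
      · simp [mul_t, one_z, one_t, symplecticForm])
    (fun a => by
      ext1
      · simp [mul_z, inv_z, one_z]
      · simp only [mul_t, inv_z, inv_t, one_t, symplecticForm, PiLp.neg_apply]
        rw [Finset.sum_eq_zero fun j _ => by ring]
        ring)

/-- The Korányi gauge `‖(z, t)‖ = (‖z‖⁴ + t²)^(1/4)`, where `‖z‖` is the Euclidean norm. -/
def gauge (p : Heisenberg n) : ℝ := (‖p.z‖ ^ 4 + p.t ^ 2) ^ (1 / 4 : ℝ)

theorem gauge_nonneg (p : Heisenberg n) : 0 ≤ p.gauge := by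
  unfold gauge; positivity

theorem gauge_pow_four (p : Heisenberg n) : p.gauge ^ 4 = ‖p.z‖ ^ 4 + p.t ^ 2 := by
  unfold gauge
  rw [← Real.rpow_natCast, ← Real.rpow_mul (by positivity)]
  norm_num

theorem gauge_one : (1 : Heisenberg n).gauge = 0 := by
  simp [gauge, one_z, one_t]

theorem gauge_inv (p : Heisenberg n) : (p⁻¹).gauge = p.gauge := by
  simp [gauge, inv_z, inv_t]

theorem eq_one_of_gauge_eq_zero {p : Heisenberg n} (h : p.gauge = 0) : p = 1 := by
  have h4 := gauge_pow_four p
  rw [h] at h4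
  have h1 : (0 : ℝ) ≤ ‖p.z‖ ^ 4 := by positivity
  have h2 : (0 : ℝ) ≤ p.t ^ 2 := by positivity
  have hz : ‖p.z‖ ^ 4 = 0 := by linarith
  have ht : p.t ^ 2 = 0 := by linarith
  ext1
  · exact norm_eq_zero.1 (pow_eq_zero_iff (by norm_num) |>.1 hz)
  · exact pow_eq_zero_iff (by norm_num) |>.1 ht

/-- Hermitian Cauchy-Schwarz inequality in real coordinates. -/
theorem inner_sq_add_symplecticForm_sq_le (z w : EuclideanSpace ℝ (Fin n ⊕ Fin n)) :
    (2 * inner ℝ z w) ^ 2 + symplecticForm z w ^ 2 ≤ (2 * (‖z‖ * ‖w‖)) ^ 2 := by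
  let f : EuclideanSpace ℝ (Fin n ⊕ Fin n) → EuclideanSpace ℂ (Fin n) := fun v =>
    WithLp.toLp 2 fun j => ⟨v (Sum.inl j), v (Sum.inr j)⟩
  have hf : ∀ v, ‖f v‖ ^ 2 = ‖v‖ ^ 2 := fun v => by
    rw [EuclideanSpace.norm_sq_eq, EuclideanSpace.norm_sq_eq, Fintype.sum_sum_type,
      ← Finset.sum_add_distrib]
    refine Finset.sum_congr rfl fun j _ => ?_
    simp only [f, Complex.sq_norm, Complex.normSq_mk, Real.norm_eq_abs, sq_abs]
    ring
  have hre : (inner ℂ (f z) (f w)).re = inner ℝ z w := by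
    simp only [PiLp.inner_apply, Fintype.sum_sum_type, Complex.re_sum, f,
      ← Finset.sum_add_distrib]
    refine Finset.sum_congr rfl fun j _ => ?_
    simp
  have him : symplecticForm z w = -2 * (inner ℂ (f z) (f w)).im := by
    simp only [PiLp.inner_apply, Complex.im_sum, f, symplecticForm]
    congr 1
    refine Finset.sum_congr rfl fun j _ => ?_
    simp
    ring
  have hcs := norm_inner_le_norm (𝕜 := ℂ) (f z) (f w)
  have hsq : ‖inner ℂ (f z) (f w)‖ ^ 2 ≤ (‖f z‖ * ‖f w‖) ^ 2 := by gcongr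
  rw [Complex.sq_norm, Complex.normSq_apply, mul_pow, hf, hf, hre] at hsq
  rw [him]
  nlinarith [hsq]

/-- The Korányi gauge is subadditive. -/
theorem gauge_mul_le (p q : Heisenberg n) : (p * q).gauge ≤ p.gauge + q.gauge := by
  have hsq : ∀ u : Heisenberg n, ‖(⟨‖u.z‖ ^ 2, u.t⟩ : ℂ)‖ = u.gauge ^ 2 := fun u => by
    have h := gauge_pow_four u
    rw [← sq_eq_sq₀ (norm_nonneg _) (by positivity), Complex.sq_norm, Complex.normSq_mk]
    linarith
  have hle : ∀ u : Heisenberg n, ‖u.z‖ ≤ u.gauge := fun u => by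
    rw [← pow_le_pow_iff_left₀ (norm_nonneg _) (gauge_nonneg u) (n := 4) (by norm_num),
      gauge_pow_four]
    nlinarith [sq_nonneg u.t]
  have hdec : (⟨‖(p * q).z‖ ^ 2, (p * q).t⟩ : ℂ) = ⟨‖p.z‖ ^ 2, p.t⟩ + ⟨‖q.z‖ ^ 2, q.t⟩
      + ⟨2 * inner ℝ p.z q.z, symplecticForm p.z q.z⟩ := by
    apply Complex.ext
    · simp only [Complex.add_re, mul_z, norm_add_sq_real]
      ring
    · simp only [Complex.add_im, mul_t]
  have hlast : ‖(⟨2 * inner ℝ p.z q.z, symplecticForm p.z q.z⟩ : ℂ)‖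
      ≤ 2 * (p.gauge * q.gauge) := by
    have h1 : ‖(⟨2 * inner ℝ p.z q.z, symplecticForm p.z q.z⟩ : ℂ)‖
        ≤ 2 * (‖p.z‖ * ‖q.z‖) := by
      refine (sq_le_sq₀ (norm_nonneg _) (by positivity)).1 ?_
      rw [Complex.sq_norm, Complex.normSq_mk]
      nlinarith [inner_sq_add_symplecticForm_sq_le p.z q.z]
    have h2 : ‖p.z‖ * ‖q.z‖ ≤ p.gauge * q.gauge :=
      mul_le_mul (hle p) (hle q) (norm_nonneg _) (gauge_nonneg p)
    linarith
  have hmain : (p * q).gauge ^ 2 ≤ (p.gauge + q.gauge) ^ 2 := by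
    rw [← hsq, hdec]
    refine (norm_add₃_le).trans ?_
    rw [hsq, hsq]
    nlinarith [hlast]
  exact (sq_le_sq₀ (gauge_nonneg _) (add_nonneg (gauge_nonneg p) (gauge_nonneg q))).1 hmain

/-- `ℍⁿ` with the Korányi metric `d(p, q) = ‖p⁻¹ · q‖`. -/
instance : MetricSpace (Heisenberg n) where
  dist p q := (p⁻¹ * q).gauge
  dist_self p := by
    rw [inv_mul_cancel, gauge_one]
  dist_comm p q := by
    rw [← gauge_inv, mul_inv_rev, inv_inv]
  dist_triangle p q r := by
    have h : p⁻¹ * r = (p⁻¹ * q) * (q⁻¹ * r) := by group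
    rw [h]
    exact gauge_mul_le _ _
  eq_of_dist_eq_zero {p q} h := by
    exact inv_mul_eq_one.1 (eq_one_of_gauge_eq_zero h)

theorem dist_def (p q : Heisenberg n) : dist p q = (p⁻¹ * q).gauge := rfl

/-- The Borel σ-algebra of `(ℍⁿ, d)`. -/
instance : MeasurableSpace (Heisenberg n) := borel _

instance : BorelSpace (Heisenberg n) := ⟨rfl⟩

end Heisenberg

/-- A Radon measure `μ` on a metric space is `s`-uniform if there is a constant `c > 0` such that
`μ (B(x, r)) = c rˢ` for all `x ∈ supp μ` and all `r > 0`, where `B(x, r)` is the closed ball. -/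
def IsUniformMeasure {X : Type*} [MetricSpace X] [MeasurableSpace X] [BorelSpace X]
    (s : ℝ) (μ : Measure X) : Prop :=
  μ.Regular ∧ ∃ c : ℝ, 0 < c ∧ ∀ x ∈ μ.support, ∀ r : ℝ, 0 < r →
    μ (Metric.closedBall x r) = ENNReal.ofReal (c * r ^ s)

/-- The set `S` supports an `s`-uniform measure: it is the support of one. -/
def SupportsUniformMeasure {X : Type*} [MetricSpace X] [MeasurableSpace X] [BorelSpace X]
    (s : ℝ) (S : Set X) : Prop :=
  ∃ μ : Measure X, IsUniformMeasure s μ ∧ μ.support = S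

/-- The light cone `x₁² + x₂² + x₃² = x₄²` in `ℝ⁴`. -/
def lightCone : Set (EuclideanSpace ℝ (Fin 4)) :=
  {x | x 3 ^ 2 = x 0 ^ 2 + x 1 ^ 2 + x 2 ^ 2}

/-- The set of points `(x₁, …, x_k, 0, …, 0, t)` of `ℍⁿ` with `(x₁, x₂, x₃, x₄)` in the light cone
and `t ∈ ℝ` arbitrary. -/
def verticalLightCone {n : ℕ} (hn : 4 ≤ n) (k : ℕ) : Set (Heisenberg n) :=
  {p | WithLp.toLp 2 (fun i : Fin 4 => p.z (Sum.inl (Fin.castLE hn i))) ∈ lightCone ∧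
    (∀ j : Fin n, k ≤ (j : ℕ) → p.z (Sum.inl j) = 0) ∧ ∀ j : Fin n, p.z (Sum.inr j) = 0}

/-- The set of points `(x₁, …, x_k, 0, …, 0, 0)` of `ℍⁿ` with `(x₁, x₂, x₃, x₄)` in the light
cone. -/
def horizontalLightCone {n : ℕ} (hn : 4 ≤ n) (k : ℕ) : Set (Heisenberg n) :=
  {p | WithLp.toLp 2 (fun i : Fin 4 => p.z (Sum.inl (Fin.castLE hn i))) ∈ lightCone ∧
    (∀ j : Fin n, k ≤ (j : ℕ) → p.z (Sum.inl j) = 0) ∧ (∀ j : Fin n, p.z (Sum.inr j) = 0) ∧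
    p.t = 0}

end

/-!
The light cone is the union of the two graphs `(v, |v|)` and `(v, -|v|)` over `v ∈ ℝ³`, and its
surface measure is a constant multiple of `dv` on both of them. For a point `(a, |a|)` of the cone,

  `|v - a|² + (± |v| - |a|)² = 2 |v|² + 2 |a|² - 2 (⟨a, v⟩ ± |a| |v|)`.

By Archimedes' theorem `⟨a, v⟩` is uniformly distributed on `[-|a| |v|, |a| |v|]` when `v` runs
through a sphere (`lintegral_norm_coord`). So the values of `⟨a, v⟩ + |a| |v|` and
`⟨a, v⟩ - |a| |v|` together fill `[-2 |a| |v|, 2 |a| |v|]` uniformly, as the values of `2 ⟨a, v⟩`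
do, counted twice (`volume_translates_add`). Hence the two sheets together meet the ball of radius
`r` around `(a, |a|)` in `2 vol {v : 2 |v - a|² ≤ r²}`, which does not depend on `a` except by a
translation (`volume_cone_sheets_add`). Integrating over the remaining coordinates `y ∈ ℝᵐ`
replaces this by the volume of `{2 |v - a|² + |y - b|² ≤ r²}`, which is `c r^(3 + m)`
(`isUniformOn_coneMeasure`).

The Korányi metric is Euclidean on `ℝⁿ × {0} × {0}`, where the symplectic form vanishes, so the
horizontal cone inherits the measure through an isometry. On `ℝⁿ × {0} × ℝ` the fourth power of
the metric is `‖x - y‖⁴ + (t - u)²`, and integrating `c (r⁴ - (t - t₀)²)^(s/4)` over `t` gives a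
multiple of `r^(s + 2)` (`IsUniformOn.map_ofReal_prod`). Push-forward by an isometry keeps the
measures of balls, and the Heisenberg group is proper, so that all these locally finite measures
are Radon.
-/

open Set Metric Module
open scoped ENNReal Topology

/-! ### Cylindrical coordinates in `ℝ³` -/

/-- The substitution `ρ = √(s² + τ²)`. -/
lemma setLIntegral_Ioi_sqrt_add_sq (s : ℝ) (g : ℝ → ℝ≥0∞) :
    ∫⁻ τ in Ioi (0 : ℝ), ENNReal.ofReal τ * g (√(s ^ 2 + τ ^ 2)) =
      ∫⁻ ρ in Ioi |s|, ENNReal.ofReal ρ * g ρ := by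
  have himage : (fun τ : ℝ => √(s ^ 2 + τ ^ 2)) '' Ioi 0 = Ioi |s| := by
    ext ρ
    simp only [mem_image, mem_Ioi]
    constructor
    · rintro ⟨τ, hτ, rfl⟩
      exact Real.lt_sqrt_of_sq_lt (by rw [sq_abs]; nlinarith)
    · intro h
      have hs := abs_nonneg s
      have hlt : s ^ 2 < ρ ^ 2 := by rw [← sq_abs s]; gcongr
      refine ⟨√(ρ ^ 2 - s ^ 2), Real.sqrt_pos.2 (by linarith), ?_⟩
      rw [Real.sq_sqrt (by linarith), add_sub_cancel, Real.sqrt_sq (by linarith)]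
  have hderiv : ∀ τ ∈ Ioi (0 : ℝ), HasDerivWithinAt (fun τ : ℝ => √(s ^ 2 + τ ^ 2))
      (τ / √(s ^ 2 + τ ^ 2)) (Ioi 0) τ := by
    intro τ hτ
    have hpos : 0 < s ^ 2 + τ ^ 2 := by have := mem_Ioi.1 hτ; positivity
    have h := ((hasDerivAt_pow 2 τ).const_add (s ^ 2)).sqrt hpos.ne'
    rw [Nat.cast_ofNat, pow_one, mul_div_mul_left _ _ two_ne_zero] at h
    exact h.hasDerivWithinAt
  have hinj : InjOn (fun τ : ℝ => √(s ^ 2 + τ ^ 2)) (Ioi 0) := by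
    intro x hx y hy hxy
    have hx' := mem_Ioi.1 hx
    have hy' := mem_Ioi.1 hy
    have h := (Real.sqrt_inj (by positivity) (by positivity)).1 hxy
    exact (sq_eq_sq₀ hx'.le hy'.le).1 (by linarith)
  rw [← himage, lintegral_image_eq_lintegral_abs_deriv_mul measurableSet_Ioi hderiv hinj]
  refine setLIntegral_congr_fun measurableSet_Ioi fun τ hτ => ?_
  have hτ' := mem_Ioi.1 hτ
  have hpos : 0 < √(s ^ 2 + τ ^ 2) := Real.sqrt_pos.2 (by positivity)
  rw [← mul_assoc, ← ENNReal.ofReal_mul (abs_nonneg _), abs_of_pos (div_pos hτ' hpos),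
    div_mul_cancel₀ _ hpos.ne']

/-- Integration in the plane of a function of `√(s² + |p|²)`. -/
lemma lintegral_sqrt_add_sq_add_sq (s : ℝ) (g : ℝ → ℝ≥0∞) (hg : Measurable g) :
    ∫⁻ p : ℝ × ℝ, g (√(s ^ 2 + (p.1 ^ 2 + p.2 ^ 2))) =
      ENNReal.ofReal (2 * Real.pi) * ∫⁻ ρ in Ioi |s|, ENNReal.ofReal ρ * g ρ := by
  have hmeas : Measurable fun τ : ℝ => ENNReal.ofReal τ * g (√(s ^ 2 + τ ^ 2)) := by fun_prop
  rw [← setLIntegral_Ioi_sqrt_add_sq, ← lintegral_comp_polarCoord_symm]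
  have htarget : polarCoord.target = Ioi (0 : ℝ) ×ˢ Ioo (-Real.pi) Real.pi := rfl
  have hcongr : ∀ p : ℝ × ℝ, ENNReal.ofReal p.1 •
      g (√(s ^ 2 + ((polarCoord.symm p).1 ^ 2 + (polarCoord.symm p).2 ^ 2))) =
      ENNReal.ofReal p.1 * g (√(s ^ 2 + p.1 ^ 2)) := fun p => by
    have : (p.1 * Real.cos p.2) ^ 2 + (p.1 * Real.sin p.2) ^ 2 = p.1 ^ 2 := by
      rw [mul_pow, mul_pow, ← mul_add, Real.cos_sq_add_sin_sq, mul_one]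
    rw [polarCoord_symm_apply, this, smul_eq_mul]
  simp_rw [hcongr]
  rw [htarget, Measure.volume_eq_prod, ← Measure.prod_restrict,
    lintegral_prod _ (by fun_prop)]
  simp only [lintegral_const, Measure.restrict_apply_univ, Real.volume_Ioo]
  rw [lintegral_mul_const _ hmeas, mul_comm]
  congr 2
  ring

/-- The map `v ↦ (|v|, v₀)` pushes Lebesgue measure of `ℝ³` to `2πρ dρ ds` on `|s| < ρ`: on a
sphere each coordinate is uniformly distributed (Archimedes). -/
lemma lintegral_norm_coord (g : ℝ → ℝ → ℝ≥0∞) (hg : Measurable (Function.uncurry g)) :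
    ∫⁻ v : EuclideanSpace ℝ (Fin 3), g ‖v‖ (v 0) =
      ∫⁻ ρ in Ioi (0 : ℝ), ENNReal.ofReal (2 * Real.pi) *
        (ENNReal.ofReal ρ * ∫⁻ s in Ioo (-ρ) ρ, g ρ s) := by
  have hvol : ∫⁻ v : EuclideanSpace ℝ (Fin 3), g ‖v‖ (v 0) =
      ∫⁻ s : ℝ, ∫⁻ p : ℝ × ℝ, g (√(s ^ 2 + (p.1 ^ 2 + p.2 ^ 2))) s := by
    have h1 := (PiLp.volume_preserving_toLp (Fin 3)).lintegral_comp_emb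
      (MeasurableEquiv.toLp 2 (Fin 3 → ℝ)).measurableEmbedding
      (fun v : EuclideanSpace ℝ (Fin 3) => g ‖v‖ (v 0))
    have h2 := (volume_preserving_piFinSuccAbove (fun _ : Fin 3 => ℝ) 0).symm.lintegral_comp_emb
      (MeasurableEquiv.measurableEmbedding _)
      (fun w : Fin 3 → ℝ => g ‖WithLp.toLp 2 w‖ (w 0))
    rw [← h1]
    refine h2.symm.trans ?_
    rw [Measure.volume_eq_prod, lintegral_prod]
    · refine lintegral_congr fun s => ?_
      rw [← (volume_preserving_finTwoArrow ℝ).symm.lintegral_comp_emb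
        (MeasurableEquiv.measurableEmbedding _)]
      refine lintegral_congr fun p => ?_
      simp [MeasurableEquiv.piFinSuccAbove, EuclideanSpace.norm_eq, Fin.sum_univ_three,
        MeasurableEquiv.finTwoArrow, Fin.insertNthEquiv, Fin.cons, add_assoc, Fin.cases]
    · refine Measurable.aemeasurable ?_
      have : Measurable fun w : Fin 3 → ℝ => g ‖WithLp.toLp 2 w‖ (w 0) := by
        refine hg.comp (Measurable.prodMk ?_ (measurable_pi_apply 0))
        exact ((PiLp.continuous_toLp 2 _).norm).measurable
      exact this.comp (MeasurableEquiv.measurable _)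
  rw [hvol]
  have hstep : ∀ s : ℝ, ∫⁻ p : ℝ × ℝ, g (√(s ^ 2 + (p.1 ^ 2 + p.2 ^ 2))) s =
      ∫⁻ ρ : ℝ, ENNReal.ofReal (2 * Real.pi) *
        (Ioi |s|).indicator (fun ρ => ENNReal.ofReal ρ * g ρ s) ρ := fun s => by
    have hgs : Measurable fun ρ => g ρ s := hg.comp (by fun_prop : Measurable fun ρ => (ρ, s))
    rw [lintegral_sqrt_add_sq_add_sq s (fun ρ => g ρ s) hgs, lintegral_const_mul,
      lintegral_indicator measurableSet_Ioi]
    exact (by fun_prop : Measurable fun ρ => ENNReal.ofReal ρ * g ρ s).indicator measurableSet_Ioi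
  simp_rw [hstep]
  have hset : MeasurableSet {q : ℝ × ℝ | |q.1| < q.2} :=
    measurableSet_lt (by fun_prop) (by fun_prop)
  have hmeas : Measurable (Function.uncurry fun s ρ : ℝ => ENNReal.ofReal (2 * Real.pi) *
      (Ioi |s|).indicator (fun ρ => ENNReal.ofReal ρ * g ρ s) ρ) := by
    have hF : Measurable fun q : ℝ × ℝ => ENNReal.ofReal q.2 * g q.2 q.1 :=
      (by fun_prop : Measurable fun q : ℝ × ℝ => ENNReal.ofReal q.2).mul
        (hg.comp measurable_swap)
    exact (hF.indicator hset).const_mul _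
  rw [lintegral_lintegral_swap hmeas.aemeasurable, ← lintegral_indicator measurableSet_Ioi]
  refine lintegral_congr fun ρ => ?_
  have hgρ : Measurable fun s => g ρ s := hg.comp (by fun_prop : Measurable fun s => (ρ, s))
  by_cases hρ : ρ ∈ Ioi (0 : ℝ)
  · rw [indicator_of_mem hρ, ← lintegral_indicator measurableSet_Ioo, ← lintegral_const_mul,
      ← lintegral_const_mul]
    · refine lintegral_congr fun s => ?_
      by_cases hs : |s| < ρ
      · rw [indicator_of_mem (mem_Ioi.2 hs), indicator_of_mem (mem_Ioo.2 (abs_lt.1 hs))]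
      · rw [indicator_of_notMem (by simpa using hs),
          indicator_of_notMem (fun h : s ∈ Ioo (-ρ) ρ => hs (abs_lt.2 h))]
        simp only [mul_zero]
    · exact (hgρ.indicator measurableSet_Ioo).const_mul _
    · exact hgρ.indicator measurableSet_Ioo
  · rw [indicator_of_notMem hρ]
    refine (lintegral_congr fun s => ?_).trans lintegral_zero
    rw [indicator_of_notMem, mul_zero]
    simp only [mem_Ioi, not_lt] at hρ ⊢
    exact hρ.trans (abs_nonneg s)

/-- There is a rotation taking the first axis to the direction of `a`. -/
lemma exists_linearIsometryEquiv_smul_single (a : EuclideanSpace ℝ (Fin 3)) :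
    ∃ R : EuclideanSpace ℝ (Fin 3) ≃ₗᵢ[ℝ] EuclideanSpace ℝ (Fin 3),
      R (‖a‖ • EuclideanSpace.single 0 1) = a :=
  ⟨_, Submodule.reflection_sub (v := ‖a‖ • EuclideanSpace.single 0 1) (by simp [norm_smul])⟩

/-- The joint distribution of `|v|` and `⟨a, v⟩` under Lebesgue measure of `ℝ³`. -/
lemma volume_setOf_norm_inner_mem (a : EuclideanSpace ℝ (Fin 3)) {U : Set (ℝ × ℝ)}
    (hU : MeasurableSet U) :
    volume {v : EuclideanSpace ℝ (Fin 3) | (‖v‖, inner ℝ a v) ∈ U} =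
      ∫⁻ ρ in Ioi (0 : ℝ), ENNReal.ofReal (2 * Real.pi) *
        (ENNReal.ofReal ρ * volume ({s | (ρ, ‖a‖ * s) ∈ U} ∩ Ioo (-ρ) ρ)) := by
  obtain ⟨R, hR⟩ := exists_linearIsometryEquiv_smul_single a
  have hmeas : MeasurableSet {v : EuclideanSpace ℝ (Fin 3) | (‖v‖, inner ℝ a v) ∈ U} :=
    hU.preimage (by fun_prop)
  have hpre : R ⁻¹' {v | (‖v‖, inner ℝ a v) ∈ U} =
      {v : EuclideanSpace ℝ (Fin 3) | (‖v‖, ‖a‖ * v 0) ∈ U} := by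
    ext v
    have h : inner ℝ a (R v) = ‖a‖ * v 0 := by
      conv_lhs => rw [← hR, R.inner_map_map, inner_smul_left]
      simp [EuclideanSpace.inner_single_left]
    simp only [mem_preimage, mem_ofPred_eq, R.norm_map, h]
  have hmeas' : MeasurableSet {v : EuclideanSpace ℝ (Fin 3) | (‖v‖, ‖a‖ * v 0) ∈ U} :=
    hU.preimage (by fun_prop)
  rw [← R.measurePreserving.measure_preimage hmeas.nullMeasurableSet, hpre,
    ← lintegral_indicator_one hmeas']
  have hU' : MeasurableSet {q : ℝ × ℝ | (q.1, ‖a‖ * q.2) ∈ U} := hU.preimage (by fun_prop)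
  have h := lintegral_norm_coord
    (fun ρ s => {q : ℝ × ℝ | (q.1, ‖a‖ * q.2) ∈ U}.indicator 1 (ρ, s))
    (measurable_one.indicator hU')
  refine Eq.trans ?_ (h.trans ?_)
  · rfl
  · refine lintegral_congr fun ρ => ?_
    have hs : MeasurableSet {s | (ρ, ‖a‖ * s) ∈ U} := hU.preimage (by fun_prop)
    rw [← Measure.restrict_apply hs, ← lintegral_indicator_one hs]
    rfl

/-! ### Balls centred on the light cone -/

/-- Up to a null set, the translates `s + ρ` and `s - ρ` of `|s| < ρ` tile `|w| < 2ρ`, which is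
also the dilate `2s`; the factor `2` is the Jacobian of the dilation. -/
lemma volume_translates_add (ρ : ℝ) (hρ : 0 < ρ) {H : Set ℝ} (hH : MeasurableSet H) :
    volume ({s | s + ρ ∈ H} ∩ Ioo (-ρ) ρ) + volume ({s | s - ρ ∈ H} ∩ Ioo (-ρ) ρ) =
      2 * volume ({s | 2 * s ∈ H} ∩ Ioo (-ρ) ρ) := by
  have h1 : {s | s + ρ ∈ H} ∩ Ioo (-ρ) ρ = (fun s => s + ρ) ⁻¹' (H ∩ Ioo 0 (2 * ρ)) := by
    ext s
    simp only [mem_inter_iff, mem_ofPred_eq, mem_Ioo, mem_preimage]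
    refine and_congr_right fun _ => ⟨fun h => ⟨?_, ?_⟩, fun h => ⟨?_, ?_⟩⟩ <;> linarith [h.1, h.2]
  have h2 : {s | s - ρ ∈ H} ∩ Ioo (-ρ) ρ = (fun s => s + -ρ) ⁻¹' (H ∩ Ioo (-(2 * ρ)) 0) := by
    ext s
    simp only [mem_inter_iff, mem_ofPred_eq, mem_Ioo, mem_preimage, ← sub_eq_add_neg]
    refine and_congr_right fun _ => ⟨fun h => ⟨?_, ?_⟩, fun h => ⟨?_, ?_⟩⟩ <;> linarith [h.1, h.2]
  have h3 : {s | 2 * s ∈ H} ∩ Ioo (-ρ) ρ = (fun s => 2 * s) ⁻¹' (H ∩ Ioo (-(2 * ρ)) (2 * ρ)) := by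
    ext s
    simp only [mem_inter_iff, mem_ofPred_eq, mem_Ioo, mem_preimage]
    refine and_congr_right fun _ => ⟨fun h => ⟨?_, ?_⟩, fun h => ⟨?_, ?_⟩⟩ <;> linarith [h.1, h.2]
  have h4 : H ∩ Ioo (-(2 * ρ)) (2 * ρ) = H ∩ Ioc (-(2 * ρ)) 0 ∪ H ∩ Ioo 0 (2 * ρ) := by
    rw [← inter_union_distrib_left, Ioc_union_Ioo_eq_Ioo (by linarith) (by linarith)]
  have h5 : volume (H ∩ Ioc (-(2 * ρ)) 0) = volume (H ∩ Ioo (-(2 * ρ)) 0) :=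
    measure_congr ((Filter.EventuallyEq.refl _ H).inter Ioo_ae_eq_Ioc.symm)
  rw [h1, h2, h3, measure_preimage_add_right, measure_preimage_add_right,
    Real.volume_preimage_mul_left two_ne_zero, h4, measure_union _ (hH.inter measurableSet_Ioo),
    h5, ← mul_assoc]
  · have : (2 : ℝ≥0∞) * ENNReal.ofReal |2⁻¹| = 1 := by
      rw [← ENNReal.ofReal_ofNat 2, ← ENNReal.ofReal_mul (by norm_num)]
      norm_num
    rw [this, one_mul, add_comm]
  · refine Disjoint.mono inter_subset_right inter_subset_right ?_
    exact disjoint_left.2 fun x hx hx' => absurd hx.2 (not_le.2 hx'.1)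

/-- The two sheets `(v, |v|)` and `(v, -|v|)` of the cone, both weighted by Lebesgue measure `dv`,
together meet a ball of radius `√q` centred at a point `(a, |a|)` of the cone in twice the volume
of the ball of radius `√(q / 2)` in `ℝ³`. -/
lemma volume_cone_sheets_add (a : EuclideanSpace ℝ (Fin 3)) (q : ℝ) :
    volume {v : EuclideanSpace ℝ (Fin 3) | ‖v - a‖ ^ 2 + (‖v‖ - ‖a‖) ^ 2 ≤ q} +
      volume {v : EuclideanSpace ℝ (Fin 3) | ‖v - a‖ ^ 2 + (‖v‖ + ‖a‖) ^ 2 ≤ q} =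
    2 * volume {v : EuclideanSpace ℝ (Fin 3) | 2 * ‖v - a‖ ^ 2 ≤ q} := by
  -- Written in terms of `|v|` and `⟨a, v⟩`, all three sets are of this form.
  let U (f : ℝ → ℝ → ℝ) : Set (ℝ × ℝ) :=
    {p | 2 * p.1 ^ 2 + 2 * ‖a‖ ^ 2 - 2 * f p.1 p.2 ≤ q}
  have hU : ∀ c d : ℝ, MeasurableSet (U fun ρ x => c * x + d * (ρ * ‖a‖)) := fun c d =>
    measurableSet_le (by fun_prop) (by fun_prop)
  have key : ∀ (c d : ℝ) (S : Set (EuclideanSpace ℝ (Fin 3))),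
      (∀ v, v ∈ S ↔ 2 * ‖v‖ ^ 2 + 2 * ‖a‖ ^ 2 - 2 * (c * inner ℝ a v + d * (‖v‖ * ‖a‖)) ≤ q) →
      volume S = ∫⁻ ρ in Ioi (0 : ℝ), ENNReal.ofReal (2 * Real.pi) * (ENNReal.ofReal ρ *
        volume ({s | (ρ, ‖a‖ * s) ∈ U fun ρ x => c * x + d * (ρ * ‖a‖)} ∩ Ioo (-ρ) ρ)) := by
    intro c d S hS
    rw [← volume_setOf_norm_inner_mem a (hU c d)]
    congr 1
    ext v
    exact hS v
  have hsq : ∀ v, ‖v - a‖ ^ 2 = ‖v‖ ^ 2 - 2 * inner ℝ a v + ‖a‖ ^ 2 := fun v => by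
    rw [norm_sub_sq_real, real_inner_comm]
  have hmeas : ∀ c d : ℝ, Measurable fun ρ : ℝ => ENNReal.ofReal (2 * Real.pi) *
      (ENNReal.ofReal ρ *
        volume ({s | (ρ, ‖a‖ * s) ∈ U fun ρ x => c * x + d * (ρ * ‖a‖)} ∩ Ioo (-ρ) ρ)) := by
    intro c d
    have hset : MeasurableSet {p : ℝ × ℝ | (p.1, ‖a‖ * p.2) ∈ (U fun ρ x => c * x + d * (ρ * ‖a‖))
        ∧ -p.1 < p.2 ∧ p.2 < p.1} :=
      ((hU c d).preimage (by fun_prop)).inter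
        ((measurableSet_lt measurable_fst.neg measurable_snd).inter
          (measurableSet_lt measurable_snd measurable_fst))
    have := measurable_measure_prodMk_left (ν := (volume : Measure ℝ)) hset
    exact ((by fun_prop : Measurable ENNReal.ofReal).mul this).const_mul _
  rw [key 1 1 _ fun v => by rw [mem_ofPred_eq, hsq]; ring_nf,
    key 1 (-1) _ fun v => by rw [mem_ofPred_eq, hsq]; ring_nf,
    key 2 0 _ fun v => by rw [mem_ofPred_eq, hsq]; ring_nf,
    ← lintegral_add_left (hmeas 1 1), ← lintegral_const_mul _ (hmeas 2 0)]
  refine setLIntegral_congr_fun measurableSet_Ioi fun ρ hρ => ?_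
  -- With `w = s + ρ`, `w = s - ρ` and `w = 2 s` the three conditions become the same one.
  have hH : MeasurableSet {w : ℝ | 2 * ρ ^ 2 + 2 * ‖a‖ ^ 2 - 2 * (‖a‖ * w) ≤ q} :=
    measurableSet_le (by fun_prop) (by fun_prop)
  have h := volume_translates_add ρ hρ hH
  have e : ∀ (c d : ℝ) (f : ℝ → ℝ), (∀ s, ‖a‖ * f s = c * (‖a‖ * s) + d * (ρ * ‖a‖)) →
      {s | (ρ, ‖a‖ * s) ∈ U fun ρ x => c * x + d * (ρ * ‖a‖)} =
      {s | f s ∈ {w : ℝ | 2 * ρ ^ 2 + 2 * ‖a‖ ^ 2 - 2 * (‖a‖ * w) ≤ q}} := by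
    intro c d f hf
    ext s
    simp only [U, mem_ofPred_eq, hf]
  rw [e 1 1 (fun s => s + ρ) fun s => by ring, e 1 (-1) (fun s => s - ρ) fun s => by ring,
    e 2 0 (fun s => 2 * s) fun s => by ring, ← mul_add, ← mul_add, h]
  ring

/-! ### The uniform measure on the Euclidean light cone -/

/-- The measure `μ` is carried by the closed set `S`, and balls centred on `S` have measure
`c rˢ`. This forces `S` to be the support of `μ`. -/
def IsUniformOn {X : Type*} [MetricSpace X] [MeasurableSpace X] (s : ℝ) (S : Set X)
    (μ : Measure X) : Prop :=
  IsClosed S ∧ μ Sᶜ = 0 ∧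
    ∃ c : ℝ, 0 < c ∧ ∀ x ∈ S, ∀ r : ℝ, 0 < r → μ (closedBall x r) = ENNReal.ofReal (c * r ^ s)

/-- The set of points `(x₁, …, x_k, 0, …, 0)` of `ℝⁿ` with `(x₁, x₂, x₃, x₄)` in the light cone. -/
def euclideanLightCone {n : ℕ} (hn : 4 ≤ n) (k : ℕ) : Set (EuclideanSpace ℝ (Fin n)) :=
  {x | WithLp.toLp 2 (fun i : Fin 4 => x (Fin.castLE hn i)) ∈ lightCone ∧
    ∀ j : Fin n, k ≤ (j : ℕ) → x j = 0}

lemma isClosed_euclideanLightCone {n : ℕ} (hn : 4 ≤ n) (k : ℕ) :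
    IsClosed (euclideanLightCone hn k) := by
  refine IsClosed.inter ?_ ?_
  · exact isClosed_eq (by fun_prop) (by fun_prop)
  · have : {x : EuclideanSpace ℝ (Fin n) | ∀ j : Fin n, k ≤ (j : ℕ) → x j = 0} =
        ⋂ (j : Fin n) (_ : k ≤ (j : ℕ)), {x | x j = 0} := by ext; simp
    change IsClosed {x : EuclideanSpace ℝ (Fin n) | ∀ j : Fin n, k ≤ (j : ℕ) → x j = 0}
    rw [this]
    exact isClosed_iInter fun j => isClosed_iInter fun _ =>
      isClosed_eq (by fun_prop) (by fun_prop)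

/-- The parametrization `(v, y) ↦ (v, ε |v|, y, 0)` by `ℝ³ × ℝᵐ` of one of the two sheets
`ε = ± 1` of the light cone times `ℝᵐ`, in `ℝ^(4 + m + l)`. -/
noncomputable def coneSheet (m l : ℕ) (ε : ℝ)
    (p : EuclideanSpace ℝ (Fin 3) × EuclideanSpace ℝ (Fin m)) :
    EuclideanSpace ℝ (Fin (4 + m + l)) :=
  WithLp.toLp 2 (Fin.append (Fin.append ![p.1 0, p.1 1, p.1 2, ε * ‖p.1‖] p.2) 0)

lemma norm_coneSheet_sub_sq (m l : ℕ) (ε δ : ℝ)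
    (p q : EuclideanSpace ℝ (Fin 3) × EuclideanSpace ℝ (Fin m)) :
    ‖coneSheet m l ε p - coneSheet m l δ q‖ ^ 2 =
      ‖p.1 - q.1‖ ^ 2 + (ε * ‖p.1‖ - δ * ‖q.1‖) ^ 2 + ‖p.2 - q.2‖ ^ 2 := by
  simp [EuclideanSpace.norm_sq_eq, Fin.sum_univ_add, coneSheet, Fin.sum_univ_four,
    Fin.sum_univ_three]

lemma measurable_coneSheet (m l : ℕ) (ε : ℝ) : Measurable (coneSheet m l ε) := by
  refine (PiLp.continuous_toLp 2 _).measurable.comp (measurable_pi_lambda _ fun i => ?_)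
  induction i using Fin.addCases with
  | left i =>
    induction i using Fin.addCases with
    | left i =>
      simp only [Fin.append_left]
      fin_cases i <;> simp <;> fun_prop
    | right i => simp only [Fin.append_left, Fin.append_right]; fun_prop
  | right i => simp only [Fin.append_right]; fun_prop

lemma coneSheet_mem (m l : ℕ) (hn : 4 ≤ 4 + m + l) {ε : ℝ} (hε : ε ^ 2 = 1)
    (p : EuclideanSpace ℝ (Fin 3) × EuclideanSpace ℝ (Fin m)) :
    coneSheet m l ε p ∈ euclideanLightCone hn (4 + m) := by
  have hcast : ∀ i : Fin 4, Fin.castLE hn i = Fin.castAdd l (Fin.castAdd m i) := fun _ => rfl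
  refine ⟨?_, fun j hj => ?_⟩
  · simp [lightCone, hcast, coneSheet, mul_pow, hε, EuclideanSpace.norm_sq_eq,
      Fin.sum_univ_three]
  · induction j using Fin.addCases with
    | left i => exact absurd i.2 (not_lt.2 hj)
    | right i => simp [coneSheet]

lemma exists_eq_coneSheet (m l : ℕ) (hn : 4 ≤ 4 + m + l) {x : EuclideanSpace ℝ (Fin (4 + m + l))}
    (hx : x ∈ euclideanLightCone hn (4 + m)) :
    ∃ p, x = coneSheet m l 1 p ∨ x = coneSheet m l (-1) p := by
  have hcast : ∀ i : Fin 4, Fin.castLE hn i = Fin.castAdd l (Fin.castAdd m i) := fun _ => rfl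
  obtain ⟨h1, h2⟩ := hx
  let f : Fin 4 → ℝ := fun i => x (Fin.castLE hn i)
  let v : EuclideanSpace ℝ (Fin 3) := !₂[f 0, f 1, f 2]
  let y : EuclideanSpace ℝ (Fin m) :=
    WithLp.toLp 2 fun i => x (Fin.castAdd l (Fin.natAdd 4 i))
  have hsq : f 3 ^ 2 = ‖v‖ ^ 2 := by
    simpa [lightCone, v, f, EuclideanSpace.norm_sq_eq, Fin.sum_univ_three] using h1
  have key : ∀ ε : ℝ, f 3 = ε * ‖v‖ → x = coneSheet m l ε (v, y) := by
    intro ε hε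
    ext i
    induction i using Fin.addCases with
    | left i =>
      induction i using Fin.addCases with
      | left i =>
        simp only [coneSheet, Fin.append_left, ← hε]
        fin_cases i <;> rfl
      | right i => simp [coneSheet, y]
    | right i => simpa [coneSheet] using h2 (Fin.natAdd (4 + m) i) (by simp)
  refine ⟨(v, y), (sq_eq_sq_iff_eq_or_eq_neg.1 hsq).imp (fun h => key _ ?_) fun h => key _ ?_⟩
  · rw [h, one_mul]
  · rw [h, neg_one_mul]

/-- The sum over both sheets of the light cone times `ℝᵐ` of Lebesgue measure on the parameter
space `ℝ³ × ℝᵐ`. -/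
noncomputable def coneMeasure (m l : ℕ) : Measure (EuclideanSpace ℝ (Fin (4 + m + l))) :=
  (volume : Measure (EuclideanSpace ℝ (Fin 3) × EuclideanSpace ℝ (Fin m))).map
      (coneSheet m l 1) +
    (volume : Measure (EuclideanSpace ℝ (Fin 3) × EuclideanSpace ℝ (Fin m))).map
      (coneSheet m l (-1))

instance (m l : ℕ) : SFinite (coneMeasure m l) := by
  have : SFinite (volume : Measure (EuclideanSpace ℝ (Fin 3) × EuclideanSpace ℝ (Fin m))) :=
    inferInstanceAs (SFinite (Measure.prod volume volume))
  unfold coneMeasure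
  infer_instance

/-- The identity `volume_cone_sheets_add`, integrated over an additional factor `ℝᵐ`. -/
lemma volume_cone_sheets_prod_add {m : ℕ} (a : EuclideanSpace ℝ (Fin 3))
    (b : EuclideanSpace ℝ (Fin m)) (q : ℝ) :
    volume {p : EuclideanSpace ℝ (Fin 3) × EuclideanSpace ℝ (Fin m) |
        ‖p.1 - a‖ ^ 2 + (‖p.1‖ - ‖a‖) ^ 2 + ‖p.2 - b‖ ^ 2 ≤ q} +
      volume {p : EuclideanSpace ℝ (Fin 3) × EuclideanSpace ℝ (Fin m) |
        ‖p.1 - a‖ ^ 2 + (‖p.1‖ + ‖a‖) ^ 2 + ‖p.2 - b‖ ^ 2 ≤ q} =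
    2 * volume {p : EuclideanSpace ℝ (Fin 3) × EuclideanSpace ℝ (Fin m) |
        2 * ‖p.1 - a‖ ^ 2 + ‖p.2 - b‖ ^ 2 ≤ q} := by
  have hm1 : MeasurableSet {p : EuclideanSpace ℝ (Fin 3) × EuclideanSpace ℝ (Fin m) |
      ‖p.1 - a‖ ^ 2 + (‖p.1‖ - ‖a‖) ^ 2 + ‖p.2 - b‖ ^ 2 ≤ q} :=
    measurableSet_le (by fun_prop) (by fun_prop)
  have hm2 : MeasurableSet {p : EuclideanSpace ℝ (Fin 3) × EuclideanSpace ℝ (Fin m) |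
      ‖p.1 - a‖ ^ 2 + (‖p.1‖ + ‖a‖) ^ 2 + ‖p.2 - b‖ ^ 2 ≤ q} :=
    measurableSet_le (by fun_prop) (by fun_prop)
  have hm3 : MeasurableSet {p : EuclideanSpace ℝ (Fin 3) × EuclideanSpace ℝ (Fin m) |
      2 * ‖p.1 - a‖ ^ 2 + ‖p.2 - b‖ ^ 2 ≤ q} :=
    measurableSet_le (by fun_prop) (by fun_prop)
  rw [Measure.volume_eq_prod, Measure.prod_apply_symm hm1, Measure.prod_apply_symm hm2,
    Measure.prod_apply_symm hm3, ← lintegral_add_left (measurable_measure_prodMk_right hm1),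
    ← lintegral_const_mul _ (measurable_measure_prodMk_right hm3)]
  refine lintegral_congr fun y => ?_
  have h := volume_cone_sheets_add a (q - ‖y - b‖ ^ 2)
  simp only [le_sub_iff_add_le] at h
  exact h

/-- The ellipsoid `2|v|² + |y|² ≤ r²` has volume a constant multiple of `r^(3 + m)`. -/
lemma exists_volume_ellipsoid (m : ℕ) :
    ∃ c : ℝ, 0 < c ∧ ∀ (a : EuclideanSpace ℝ (Fin 3)) (b : EuclideanSpace ℝ (Fin m)) (r : ℝ),
      0 < r → volume {p : EuclideanSpace ℝ (Fin 3) × EuclideanSpace ℝ (Fin m) |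
        2 * ‖p.1 - a‖ ^ 2 + ‖p.2 - b‖ ^ 2 ≤ r ^ 2} = ENNReal.ofReal (c * r ^ (3 + m)) := by
  let D : Set (EuclideanSpace ℝ (Fin 3) × EuclideanSpace ℝ (Fin m)) :=
    {p | 2 * ‖p.1‖ ^ 2 + ‖p.2‖ ^ 2 ≤ 1}
  have : Measure.IsAddHaarMeasure
      (volume : Measure (EuclideanSpace ℝ (Fin 3) × EuclideanSpace ℝ (Fin m))) :=
    inferInstanceAs (Measure.prod volume volume).IsAddHaarMeasure
  have hpos : 0 < volume D := by
    refine Measure.measure_pos_of_mem_nhds volume (x := 0) (Filter.mem_of_superset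
      ((isOpen_lt (f := fun p : EuclideanSpace ℝ (Fin 3) × EuclideanSpace ℝ (Fin m) =>
        2 * ‖p.1‖ ^ 2 + ‖p.2‖ ^ 2) (g := fun _ => 1) (by fun_prop) (by fun_prop)).mem_nhds ?_)
      fun p (hp : _ < _) => hp.le)
    simp only [mem_ofPred_eq]
    simp
  have hfin : volume D < ∞ := by
    refine (measure_mono fun p hp => ?_).trans_lt (measure_closedBall_lt_top (x := 0) (r := 1))
    have hp' : 2 * ‖p.1‖ ^ 2 + ‖p.2‖ ^ 2 ≤ 1 := hp
    rw [mem_closedBall_zero_iff, Prod.norm_def, max_le_iff]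
    constructor <;> nlinarith [norm_nonneg p.1, norm_nonneg p.2]
  refine ⟨(volume D).toReal, ENNReal.toReal_pos hpos.ne' hfin.ne, fun a b r hr => ?_⟩
  have hset : {p : EuclideanSpace ℝ (Fin 3) × EuclideanSpace ℝ (Fin m) |
      2 * ‖p.1 - a‖ ^ 2 + ‖p.2 - b‖ ^ 2 ≤ r ^ 2} =
      (fun p => p + (-a, -b)) ⁻¹' ((fun p => r⁻¹ • p) ⁻¹' D) := by
    ext p
    simp only [D, mem_preimage, mem_ofPred_eq, Prod.smul_fst, Prod.smul_snd, Prod.fst_add,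
      Prod.snd_add, ← sub_eq_add_neg, norm_smul, norm_inv,
      Real.norm_of_nonneg hr.le, mul_pow, inv_pow]
    rw [← mul_le_mul_iff_right₀ (show 0 < (r ^ 2)⁻¹ by positivity),
      inv_mul_cancel₀ (by positivity : r ^ 2 ≠ 0)]
    ring_nf
  have hrank : finrank ℝ (EuclideanSpace ℝ (Fin 3) × EuclideanSpace ℝ (Fin m)) = 3 + m := by
    simp
  rw [hset, measure_preimage_add_right, Measure.addHaar_preimage_smul _ (inv_ne_zero hr.ne'),
    hrank, inv_pow, inv_inv, abs_of_pos (by positivity), mul_comm,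
    ENNReal.ofReal_mul ENNReal.toReal_nonneg, ENNReal.ofReal_toReal hfin.ne]

/-- The light cone times `ℝᵐ`, in `ℝ^(4 + m + l)`, carries a `(3 + m)`-uniform measure. -/
lemma isUniformOn_coneMeasure (m l : ℕ) (hn : 4 ≤ 4 + m + l) :
    IsUniformOn (((4 + m : ℕ) : ℝ) - 1) (euclideanLightCone hn (4 + m)) (coneMeasure m l) := by
  have hclosed := isClosed_euclideanLightCone hn (4 + m)
  refine ⟨hclosed, ?_, ?_⟩
  · have hempty : ∀ ε : ℝ, ε ^ 2 = 1 →
        coneSheet m l ε ⁻¹' (euclideanLightCone hn (4 + m))ᶜ = ∅ := fun ε hε =>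
      eq_empty_of_forall_notMem fun p hp => hp (coneSheet_mem m l hn hε p)
    rw [coneMeasure, Measure.add_apply,
      Measure.map_apply (measurable_coneSheet m l _) hclosed.measurableSet.compl,
      Measure.map_apply (measurable_coneSheet m l _) hclosed.measurableSet.compl,
      hempty _ (by norm_num), hempty _ (by norm_num), measure_empty, add_zero]
  · obtain ⟨c, hc, hvol⟩ := exists_volume_ellipsoid m
    refine ⟨2 * c, by positivity, fun x hx r hr => ?_⟩
    have hball : ∀ ε δ q, coneSheet m l ε ⁻¹' closedBall (coneSheet m l δ q) r =
        {p | ‖p.1 - q.1‖ ^ 2 + (ε * ‖p.1‖ - δ * ‖q.1‖) ^ 2 + ‖p.2 - q.2‖ ^ 2 ≤ r ^ 2} := by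
      intro ε δ q
      ext p
      rw [mem_preimage, mem_closedBall, dist_eq_norm, mem_ofPred_eq, ← norm_coneSheet_sub_sq,
        sq_le_sq₀ (norm_nonneg _) hr.le]
    have hexp : r ^ (((4 + m : ℕ) : ℝ) - 1) = r ^ (3 + m) := by
      rw [← Real.rpow_natCast]
      congr 1
      push_cast
      ring
    rw [coneMeasure, Measure.add_apply,
      Measure.map_apply (measurable_coneSheet m l _) isClosed_closedBall.measurableSet,
      Measure.map_apply (measurable_coneSheet m l _) isClosed_closedBall.measurableSet,
      hexp, mul_assoc, ENNReal.ofReal_mul two_pos.le, ENNReal.ofReal_ofNat]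
    obtain ⟨q, rfl | rfl⟩ := exists_eq_coneSheet m l hn hx
    · rw [hball, hball, ← hvol q.1 q.2 r hr, ← volume_cone_sheets_prod_add]
      congr 4 with p
      · ring_nf
      · ring_nf
    · rw [hball, hball, ← hvol q.1 q.2 r hr, ← volume_cone_sheets_prod_add, add_comm]
      congr 4 with p
      · ring_nf
      · ring_nf

/-! ### Uniform measures and isometries -/

lemma IsUniformOn.map {X Y : Type*} [MetricSpace X] [MeasurableSpace X] [BorelSpace X]
    [CompleteSpace X] [MetricSpace Y] [MeasurableSpace Y] [BorelSpace Y] {s : ℝ} {S : Set X}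
    {μ : Measure X} (h : IsUniformOn s S μ) {f : X → Y} (hf : Isometry f) :
    IsUniformOn s (f '' S) (μ.map f) := by
  obtain ⟨hS, hμ, c, hc, hball⟩ := h
  have hclosed := hf.isClosedEmbedding.isClosedMap S hS
  have hmeas := hf.continuous.measurable
  refine ⟨hclosed, ?_, c, hc, ?_⟩
  · rw [Measure.map_apply hmeas hclosed.measurableSet.compl]
    exact measure_mono_null (fun x hx hxS => hx (mem_image_of_mem f hxS)) hμ
  · rintro _ ⟨x, hx, rfl⟩ r hr
    rw [Measure.map_apply hmeas isClosed_closedBall.measurableSet, hf.preimage_closedBall,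
      hball x hx r hr]

lemma IsUniformOn.supportsUniformMeasure {X : Type*} [MetricSpace X] [MeasurableSpace X]
    [BorelSpace X] [ProperSpace X] {s : ℝ} {S : Set X} {μ : Measure X}
    (h : IsUniformOn s S μ) : SupportsUniformMeasure s S := by
  obtain ⟨hS, hμ, c, hc, hball⟩ := h
  have hfin : IsLocallyFiniteMeasure μ := ⟨fun x => by
    by_cases hx : x ∈ S
    · exact ⟨closedBall x 1, closedBall_mem_nhds x one_pos, by
        rw [hball x hx 1 one_pos]; exact ENNReal.ofReal_lt_top⟩
    · exact ⟨Sᶜ, hS.isOpen_compl.mem_nhds hx, by rw [hμ]; exact ENNReal.zero_lt_top⟩⟩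
  have hsupp : μ.support = S := by
    refine (Measure.support_subset_of_isClosed hS hμ).antisymm fun x hx => ?_
    refine (nhds_basis_closedBall.mem_measureSupport).2 fun r hr => ?_
    rw [hball x hx r hr]
    exact ENNReal.ofReal_pos.2 (by positivity)
  exact ⟨μ, ⟨inferInstance, c, hc, fun x hx => hball x (hsupp ▸ hx)⟩, hsupp⟩

/-! ### The Heisenberg group is a proper metric space -/

lemma continuous_symplecticForm {n : ℕ} :
    Continuous fun p : EuclideanSpace ℝ (Fin n ⊕ Fin n) × EuclideanSpace ℝ (Fin n ⊕ Fin n) =>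
      symplecticForm p.1 p.2 := by
  unfold symplecticForm
  fun_prop

namespace Heisenberg

/-- The Euclidean topology of `ℝ²ⁿ × ℝ` is finer than that of the Korányi metric. -/
lemma continuous_mk {n : ℕ} :
    Continuous fun p : EuclideanSpace ℝ (Fin n ⊕ Fin n) × ℝ => (⟨p.1, p.2⟩ : Heisenberg n) := by
  refine continuous_iff_continuousAt.2 fun q => tendsto_iff_dist_tendsto_zero.2 ?_
  have hcont : Continuous fun p : EuclideanSpace ℝ (Fin n ⊕ Fin n) × ℝ =>
      dist (⟨p.1, p.2⟩ : Heisenberg n) ⟨q.1, q.2⟩ := by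
    have h : Continuous fun p : EuclideanSpace ℝ (Fin n ⊕ Fin n) × ℝ =>
        symplecticForm (-p.1) q.1 :=
      continuous_symplecticForm.comp (continuous_fst.neg.prodMk continuous_const)
    simp only [dist_def, gauge, mul_z, mul_t, inv_z, inv_t]
    exact Continuous.rpow_const (by fun_prop) fun _ => Or.inr (by norm_num)
  have := hcont.tendsto q
  rwa [dist_self] at this

instance {n : ℕ} : ProperSpace (Heisenberg n) := by
  refine ⟨fun p r => ?_⟩
  have hone : IsCompact (closedBall (1 : Heisenberg n) r) := by
    refine (((isCompact_closedBall (0 : EuclideanSpace ℝ (Fin n ⊕ Fin n)) r).prod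
      (isCompact_Icc (a := -(r ^ 2)) (b := r ^ 2))).image continuous_mk).of_isClosed_subset
        isClosed_closedBall fun q hq => ?_
    have hg : q.gauge ≤ r := by
      rwa [mem_closedBall, dist_comm, dist_def, inv_one, one_mul] at hq
    have h4 : ‖q.z‖ ^ 4 + q.t ^ 2 ≤ r ^ 4 := by
      rw [← gauge_pow_four]
      exact pow_le_pow_left₀ (gauge_nonneg q) hg 4
    have hr := (gauge_nonneg q).trans hg
    refine ⟨(q.z, q.t), ⟨?_, abs_le.1 (abs_le_of_sq_le_sq ?_ (by positivity))⟩, rfl⟩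
    · rw [mem_closedBall_zero_iff]
      exact le_of_pow_le_pow_left₀ (by norm_num : 4 ≠ 0) hr (by nlinarith [sq_nonneg q.t])
    · nlinarith [pow_nonneg (norm_nonneg q.z) 4]
  have hiso : Isometry fun q : Heisenberg n => p * q :=
    Isometry.of_dist_eq fun q q' => by rw [dist_def, dist_def]; congr 1; group
  refine (hone.image hiso.continuous).of_isClosed_subset isClosed_closedBall fun q hq => ?_
  refine ⟨p⁻¹ * q, ?_, mul_inv_cancel_left p q⟩
  rwa [mem_closedBall, ← hiso.dist_eq, mul_one, mul_inv_cancel_left]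

/-! ### The abelian subgroup `ℝⁿ × {0} × ℝ` -/

/-- The point `(x, 0, t)` of `ℝⁿ × ℝⁿ × ℝ`. -/
def ofReal {n : ℕ} (x : EuclideanSpace ℝ (Fin n)) (t : ℝ) : Heisenberg n :=
  ⟨WithLp.toLp 2 (Sum.elim x 0), t⟩

/-- The symplectic form vanishes on `ℝⁿ × {0}`. -/
lemma dist_ofReal_pow_four {n : ℕ} (x y : EuclideanSpace ℝ (Fin n)) (t u : ℝ) :
    dist (ofReal x t) (ofReal y u) ^ 4 = ‖x - y‖ ^ 4 + (t - u) ^ 2 := by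
  have hz : ‖-(ofReal x t).z + (ofReal y u).z‖ ^ 2 = ‖x - y‖ ^ 2 := by
    simp only [EuclideanSpace.norm_sq_eq, ofReal, Fintype.sum_sum_type]
    simp only [PiLp.add_apply, PiLp.neg_apply, PiLp.sub_apply, Sum.elim_inl, Sum.elim_inr]
    simp only [Real.norm_eq_abs, sq_abs, Pi.zero_apply, neg_zero, add_zero, ne_eq,
      OfNat.ofNat_ne_zero, not_false_eq_true, zero_pow, Finset.sum_const_zero]
    exact Finset.sum_congr rfl fun i _ => by ring
  have hs : symplecticForm (-(ofReal x t).z) (ofReal y u).z = 0 := by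
    simp [symplecticForm, ofReal]
  rw [dist_def, gauge_pow_four, mul_z, mul_t, inv_z, inv_t, hs,
    show (4 : ℕ) = 2 * 2 from rfl, pow_mul, hz, pow_mul]
  simp only [ofReal]
  ring

lemma isometry_ofReal_zero {n : ℕ} :
    Isometry fun x : EuclideanSpace ℝ (Fin n) => ofReal x 0 :=
  Isometry.of_dist_eq fun x y => by
    rw [← pow_left_inj₀ dist_nonneg dist_nonneg four_ne_zero, dist_ofReal_pow_four, dist_eq_norm,
      sub_self, zero_pow two_ne_zero, add_zero]

lemma continuous_ofReal {n : ℕ} :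
    Continuous fun p : EuclideanSpace ℝ (Fin n) × ℝ => ofReal p.1 p.2 := by
  refine continuous_mk.comp (Continuous.prodMk ?_ continuous_snd)
  refine (PiLp.continuous_toLp 2 _).comp (continuous_pi fun i => ?_)
  cases i with
  | inl i => simp only [Sum.elim_inl]; fun_prop
  | inr i => exact continuous_const

lemma eq_ofReal {n : ℕ} {p : Heisenberg n} (hp : ∀ j, p.z (Sum.inr j) = 0) :
    p = ofReal (WithLp.toLp 2 fun j => p.z (Sum.inl j)) p.t := by
  ext i
  · cases i with
    | inl i => rfl
    | inr i => exact hp i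
  · rfl

end Heisenberg

open Heisenberg

lemma horizontalLightCone_eq_image {n : ℕ} (hn : 4 ≤ n) (k : ℕ) :
    horizontalLightCone hn k = (fun x => ofReal x 0) '' euclideanLightCone hn k := by
  ext p
  constructor
  · rintro ⟨h1, h2, h3, h4⟩
    exact ⟨_, ⟨h1, h2⟩, by simpa only [h4] using (eq_ofReal h3).symm⟩
  · rintro ⟨x, ⟨h1, h2⟩, rfl⟩
    exact ⟨h1, h2, fun _ => rfl, rfl⟩

lemma verticalLightCone_eq_image {n : ℕ} (hn : 4 ≤ n) (k : ℕ) :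
    verticalLightCone hn k =
      (fun p : EuclideanSpace ℝ (Fin n) × ℝ => ofReal p.1 p.2) ''
        (euclideanLightCone hn k ×ˢ univ) := by
  ext p
  constructor
  · rintro ⟨h1, h2, h3⟩
    exact ⟨(_, p.t), ⟨⟨h1, h2⟩, mem_univ _⟩, (eq_ofReal h3).symm⟩
  · rintro ⟨x, ⟨⟨h1, h2⟩, -⟩, rfl⟩
    exact ⟨h1, h2, fun _ => rfl⟩

/-! ### The vertical direction -/

lemma Heisenberg.continuous_z {n : ℕ} : Continuous (Heisenberg.z (n := n)) := by
  refine LipschitzWith.continuous (K := 1) (LipschitzWith.of_dist_le_mul fun p q => ?_)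
  rw [NNReal.coe_one, one_mul, dist_def, dist_comm, dist_eq_norm, sub_eq_neg_add]
  refine le_of_pow_le_pow_left₀ four_ne_zero (gauge_nonneg _) ?_
  rw [gauge_pow_four, mul_z, inv_z]
  linarith [sq_nonneg (p⁻¹ * q).t]

lemma isClosed_verticalLightCone {n : ℕ} (hn : 4 ≤ n) (k : ℕ) :
    IsClosed (verticalLightCone hn k) := by
  have hz := continuous_z (n := n)
  have hset : verticalLightCone hn k =
      (fun p => WithLp.toLp 2 fun j => p.z (Sum.inl j)) ⁻¹' euclideanLightCone hn k ∩
        ⋂ j : Fin n, {p | p.z (Sum.inr j) = 0} := by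
    ext p
    simp [verticalLightCone, euclideanLightCone, and_assoc]
  rw [hset]
  exact ((isClosed_euclideanLightCone hn k).preimage (by fun_prop)).inter
    (isClosed_iInter fun j => isClosed_eq (by fun_prop) continuous_const)

lemma lintegral_comp_sub_div (G : ℝ → ℝ≥0∞) (hG : Measurable G) (t₀ : ℝ) {R : ℝ} (hR : 0 < R) :
    ∫⁻ t, G ((t - t₀) / R) = ENNReal.ofReal R * ∫⁻ u, G u := by
  have hRinv : (R⁻¹ : ℝ) ≠ 0 := inv_ne_zero hR.ne'
  rw [lintegral_sub_right_eq_self (fun t => G (t / R)) t₀]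
  have h : ∫⁻ u, G u ∂(Measure.map (R⁻¹ * ·) volume) = ∫⁻ t, G (t / R) := by
    rw [lintegral_map hG (by fun_prop)]
    simp_rw [div_eq_inv_mul]
  rw [← h, Real.map_volume_mul_left hRinv, lintegral_smul_measure, inv_inv, abs_of_pos hR,
    smul_eq_mul]

/-- Integrating `c ρˢ` with `ρ⁴ = r⁴ - (t - t₀)²` over `t` gives a constant multiple of
`r^(s + 2)`. -/
lemma exists_lintegral_vertical {s c : ℝ} (hs : 0 ≤ s) (hc : 0 < c) :
    ∃ C : ℝ, 0 < C ∧ ∀ t₀ r : ℝ, 0 < r →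
      ∫⁻ t in {t | |t - t₀| < r ^ 2},
        ENNReal.ofReal (c * ((r ^ 4 - (t - t₀) ^ 2) ^ (1 / 4 : ℝ)) ^ s) =
      ENNReal.ofReal (C * r ^ (s + 2)) := by
  let g : ℝ → ℝ≥0∞ := fun u => ENNReal.ofReal (((1 - u ^ 2) ^ (1 / 4 : ℝ)) ^ s)
  let G : ℝ → ℝ≥0∞ := (Ioo (-1) 1).indicator g
  have hg : Measurable g := by fun_prop
  have hG : Measurable G := hg.indicator measurableSet_Ioo
  have hlt : ∫⁻ u, G u < ∞ := by
    rw [lintegral_indicator measurableSet_Ioo]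
    refine (setLIntegral_mono' (g := fun _ => 1) measurableSet_Ioo fun u hu => ?_).trans_lt
      (by simp)
    rw [ENNReal.ofReal_le_one]
    have h0 : 0 ≤ 1 - u ^ 2 := by nlinarith [hu.1, hu.2]
    exact Real.rpow_le_one (by positivity)
      (Real.rpow_le_one h0 (by nlinarith [sq_nonneg u]) (by norm_num)) hs
  have hpos : 0 < ∫⁻ u, G u := by
    rw [lintegral_indicator measurableSet_Ioo, setLIntegral_pos_iff hg]
    refine lt_of_lt_of_le ?_ (measure_mono (s := Ioo (-1) 1) fun u hu => ⟨?_, hu⟩)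
    · simp
    · have h0 : 0 < 1 - u ^ 2 := by nlinarith [hu.1, hu.2]
      exact (ENNReal.ofReal_pos.2 (by positivity)).ne'
  refine ⟨c * (∫⁻ u, G u).toReal, mul_pos hc (ENNReal.toReal_pos hpos.ne' hlt.ne),
    fun t₀ r hr => ?_⟩
  have hr2 : 0 < r ^ 2 := by positivity
  have hmeas : MeasurableSet {t | |t - t₀| < r ^ 2} :=
    measurableSet_lt (by fun_prop) (by fun_prop)
  have hpt : ∀ t, {t | |t - t₀| < r ^ 2}.indicator
      (fun t => ENNReal.ofReal (c * ((r ^ 4 - (t - t₀) ^ 2) ^ (1 / 4 : ℝ)) ^ s)) t =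
      ENNReal.ofReal (c * r ^ s) * G ((t - t₀) / r ^ 2) := by
    intro t
    have hiff : (t - t₀) / r ^ 2 ∈ Ioo (-1 : ℝ) 1 ↔ |t - t₀| < r ^ 2 := by
      rw [mem_Ioo, ← abs_lt, abs_div, abs_of_pos hr2, div_lt_one hr2]
    by_cases ht : |t - t₀| < r ^ 2
    · rw [indicator_of_mem (by exact ht), show G ((t - t₀) / r ^ 2) = _ from indicator_of_mem (hiff.2 ht) g,
        ← ENNReal.ofReal_mul (by positivity), mul_assoc]
      have h0 : 0 ≤ 1 - ((t - t₀) / r ^ 2) ^ 2 := by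
        have := hiff.2 ht
        nlinarith [this.1, this.2]
      have h1 : r ^ 4 - (t - t₀) ^ 2 = r ^ 4 * (1 - ((t - t₀) / r ^ 2) ^ 2) := by
        field_simp
      have h2 : (r ^ 4) ^ (1 / 4 : ℝ) = r := by
        rw [← Real.rpow_natCast, ← Real.rpow_mul hr.le]
        norm_num
      rw [h1, Real.mul_rpow (by positivity) h0, h2, Real.mul_rpow hr.le (by positivity)]
    · rw [indicator_of_notMem (by exact ht), show G ((t - t₀) / r ^ 2) = 0 from
        indicator_of_notMem (fun h => ht (hiff.1 h)) g, mul_zero]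
  rw [← lintegral_indicator hmeas]
  simp_rw [hpt]
  rw [lintegral_const_mul _ (by fun_prop), lintegral_comp_sub_div G hG t₀ hr2,
    Real.rpow_add hr, Real.rpow_two, ← ENNReal.ofReal_toReal hlt.ne,
    ← ENNReal.ofReal_mul hr2.le, ← ENNReal.ofReal_mul (by positivity)]
  congr 1
  simp only [ENNReal.toReal_ofReal ENNReal.toReal_nonneg]
  ring

/-- The product with `dt` of an `s`-uniform measure on the light cone in `ℝⁿ` is `(s + 2)`-uniform
for the Korányi metric, as vertical distances are square roots of Euclidean ones. -/
lemma IsUniformOn.map_ofReal_prod {n : ℕ} (hn : 4 ≤ n) (k : ℕ) {s : ℝ} (hs : 0 ≤ s)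
    {μ : Measure (EuclideanSpace ℝ (Fin n))} [SFinite μ]
    (h : IsUniformOn s (euclideanLightCone hn k) μ) :
    IsUniformOn (s + 2) (verticalLightCone hn k)
      ((μ.prod volume).map fun p : EuclideanSpace ℝ (Fin n) × ℝ => ofReal p.1 p.2) := by
  obtain ⟨hS, hμ, c, hc, hball⟩ := h
  have hclosed := isClosed_verticalLightCone hn k
  have hmeas : Measurable fun p : EuclideanSpace ℝ (Fin n) × ℝ => ofReal p.1 p.2 :=
    continuous_ofReal.measurable
  obtain ⟨C, hC, hint⟩ := exists_lintegral_vertical hs hc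
  refine ⟨hclosed, ?_, C, hC, ?_⟩
  · rw [Measure.map_apply hmeas hclosed.measurableSet.compl]
    refine measure_mono_null (t := (euclideanLightCone hn k)ᶜ ×ˢ univ) ?_ ?_
    · rintro ⟨x, t⟩ hx
      refine ⟨fun hxS => hx ?_, mem_univ _⟩
      rw [verticalLightCone_eq_image]
      exact mem_image_of_mem _ ⟨hxS, mem_univ _⟩
    · rw [Measure.prod_prod, hμ, zero_mul]
  · rw [verticalLightCone_eq_image]
    rintro _ ⟨⟨x₀, t₀⟩, ⟨hx₀, -⟩, rfl⟩ r hr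
    rw [← hint t₀ r hr, Measure.map_apply hmeas isClosed_closedBall.measurableSet,
      Measure.prod_apply_symm (isClosed_closedBall.measurableSet.preimage hmeas),
      ← lintegral_indicator (measurableSet_lt (by fun_prop) (by fun_prop))]
    have hmem : ∀ x t, ofReal x t ∈ closedBall (ofReal x₀ t₀) r ↔
        ‖x - x₀‖ ^ 4 + (t - t₀) ^ 2 ≤ r ^ 4 := fun x t => by
      rw [mem_closedBall, ← dist_ofReal_pow_four,
        pow_le_pow_iff_left₀ dist_nonneg hr.le four_ne_zero]
    -- On the null set `|t - t₀| = r²` the section is a single point.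
    have hae : ∀ᵐ t : ℝ, t ∉ ({t₀ + r ^ 2, t₀ - r ^ 2} : Set ℝ) :=
      measure_eq_zero_iff_ae_notMem.1 ((toFinite _).measure_zero volume)
    refine lintegral_congr_ae (hae.mono fun t ht => ?_)
    simp only [mem_insert_iff, mem_singleton_iff, not_or] at ht
    have hr2 : 0 < r ^ 2 := by positivity
    rcases lt_or_ge (|t - t₀|) (r ^ 2) with hlt | hge
    · have hq : 0 < r ^ 4 - (t - t₀) ^ 2 := by
        have := sq_lt_sq' (abs_lt.1 hlt).1 (abs_lt.1 hlt).2
        nlinarith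
      rw [indicator_of_mem (by exact hlt), ← hball x₀ hx₀ _ (by positivity)]
      refine congrArg μ (Set.ext fun x => ?_)
      have hroot : ((r ^ 4 - (t - t₀) ^ 2) ^ (1 / 4 : ℝ)) ^ 4 = r ^ 4 - (t - t₀) ^ 2 := by
        rw [← Real.rpow_natCast, ← Real.rpow_mul hq.le]
        norm_num
      rw [mem_preimage, mem_preimage, hmem, mem_closedBall, dist_eq_norm,
        ← pow_le_pow_iff_left₀ (norm_nonneg _) (by positivity) four_ne_zero, hroot]
      exact le_sub_iff_add_le.symm
    · have hgt : r ^ 2 < |t - t₀| := by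
        refine lt_of_le_of_ne hge fun heq => ?_
        rcases abs_choice (t - t₀) with h | h <;> rw [h] at heq
        · exact ht.1 (by linarith)
        · exact ht.2 (by linarith)
      rw [indicator_of_notMem (by exact not_lt.2 hge)]
      convert measure_empty (μ := μ)
      refine eq_empty_of_forall_notMem fun x hx => ?_
      have hx' := (hmem x t).1 hx
      have h1 : (r ^ 2) ^ 2 < (t - t₀) ^ 2 := by rw [← sq_abs (t - t₀)]; gcongr
      nlinarith [pow_nonneg (norm_nonneg (x - x₀)) 4]

theorem mainTheorem5 (n k : ℕ) (hn : 4 ≤ n) (hk : 4 ≤ k) (hkn : k ≤ n) :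
    (SupportsUniformMeasure ((k : ℝ) - 1) (horizontalLightCone hn k) ∧
      ∀ Φ : Heisenberg n → Heisenberg n, Isometry Φ →
        SupportsUniformMeasure ((k : ℝ) - 1) (Φ '' horizontalLightCone hn k)) ∧
    (SupportsUniformMeasure ((k : ℝ) + 1) (verticalLightCone hn k) ∧
      ∀ Φ : Heisenberg n → Heisenberg n, Isometry Φ →
        SupportsUniformMeasure ((k : ℝ) + 1) (Φ '' verticalLightCone hn k)) := by
  obtain ⟨m, rfl⟩ := Nat.exists_eq_add_of_le hk
  obtain ⟨l, rfl⟩ := Nat.exists_eq_add_of_le hkn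
  have hcone := isUniformOn_coneMeasure m l hn
  have hhor := hcone.map isometry_ofReal_zero
  rw [← horizontalLightCone_eq_image] at hhor
  have hs : (0 : ℝ) ≤ ((4 + m : ℕ) : ℝ) - 1 := by
    push_cast
    linarith [(Nat.cast_nonneg m : (0 : ℝ) ≤ m)]
  have hver := hcone.map_ofReal_prod hn (4 + m) hs
  rw [show ((4 + m : ℕ) : ℝ) - 1 + 2 = ((4 + m : ℕ) : ℝ) + 1 by ring] at hver
  exact ⟨⟨hhor.supportsUniformMeasure, fun Φ hΦ => (hhor.map hΦ).supportsUniformMeasure⟩,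
    hver.supportsUniformMeasure, fun Φ hΦ => (hver.map hΦ).supportsUniformMeasure⟩
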